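/- Let $\mathcal{C}=\mathbb{Q}[\hbar]$ and let $\mathfrak{h}^1=\mathcal{C}\langle z_1,z_2,\ldots\rangle$ be the free non-commutative polynomial algebra on letters $z_k$ ($k\ge 1$). Let $\mathfrak{h}^1_{>0}$ be the $\mathcal{C}$-submodule spanned by the non-empty words, and $\mathfrak{h}^0$ the $\mathcal{C}$-submodule spanned by $1$ and the words $z_{k_1}\cdots z_{k_r}$ with $r\ge 1$, $k_1\ge 2$. Let $\hbar$ act on $\mathbb{Q}[[q]]$ as multiplication by $1-q$, and put $[m]=(1-q^m)/(1-q)$. The $q$-analogue of the multiple zeta star value is the $\mathcal{C}$-linear map $\zeta_q^\star:\mathfrak{h}^0\to\mathbb{Q}[[q]]$ given by $\zeta_q^\star(1)=1$ and $$\zeta_q^\star(z_{k_1}\cdots z_{k_r})=\sum_{m_1\ge\cdots\ge m_r\ge 1}\frac{q^{(k_1-1)m_1+\cdots+(k_r-1)m_r}}{[m_1]^{k_1}\cdots[m_r]^{k_r}},$$ where the sum converges in the $q$-adic topology. Define: - the $\mathcal{C}$-bilinear product $*_-$ on $\mathfrak{h}^1$ by $1*_-w=w*_-1=w$ and $$(z_iw_1)*_-(z_jw_2)=z_i(w_1*_-z_jw_2)+z_j(z_iw_1*_-w_2)+(-z_{i+j}+\hbar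 z_{i+j-1})(w_1*_-w_2)\qquad(i,j\ge 1);$$ - the $\mathcal{C}$-linear map $z_1\circ(\cdot)$ on $\mathfrak{h}^1$ by $z_1\circ 1=0$ and $z_1\circ(z_jw)=z_{j+1}w$; - the $\mathcal{C}$-linear map $\phi$ on $\mathfrak{h}^1$ as follows: for a word $u=z_{k_1}\cdots z_{k_r}$, let $I_u=\{k_1+\cdots+k_j \mid 1\le j<r\}$ and $\{1,\ldots,k_1+\cdots+k_r\}\setminus I_u=\{p_1<\cdots<p_l\}$; then $\phi(u)=z_{p_1}z_{p_2-p_1}\cdots z_{p_l-p_{l-1}}$ (and $\phi(1)=1$). Then for all $w_1,w_2\in\mathfrak{h}^1_{>0}$ the element $z_1\circ\phi(w_1*_-w_2)$ lies in $\mathfrak{h}^0$, and $$\zeta_q^\star\bigl(z_1\circ\phi(w_1*_-w_2)\bigr)=0\quad\text{in }\mathbb{Q}[[q]].$$ -/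

import Mathlib

open PowerSeries

noncomputable section

namespace QMZV

/-- The coefficient ring `ℚ[ℏ]`; the formal variable `ℏ` is `Polynomial.X`. -/
abbrev Coeff : Type := Polynomial ℚ

/-- The formal variable `ℏ`. -/
abbrev hbar : Coeff := Polynomial.X

/-- The non-commutative polynomial algebra over `ℚ[ℏ]` freely generated by the letters
`z₁, z₂, …`. -/
abbrev H1 : Type := FreeAlgebra Coeff ℕ+

/-- The letter `z_i`. -/
abbrev z (i : ℕ+) : H1 := FreeAlgebra.ι Coeff i

/-- The word `z_{k₁} ⋯ z_{k_r}` attached to the list `[k₁, …, k_r]`; the empty list gives `1`. -/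
def word (u : List ℕ+) : H1 := (u.map z).prod

/-- The basis of `H1` formed by the words. -/
def wordBasis : Module.Basis (List ℕ+) Coeff H1 :=
  (FreeAlgebra.basisFreeMonoid Coeff ℕ+).reindex FreeMonoid.toList

theorem wordBasis_apply (u : List ℕ+) : wordBasis u = word u := by
  have h : FreeAlgebra.equivMonoidAlgebraFreeMonoid (R := Coeff) (X := ℕ+) (word u) =
      MonoidAlgebra.single (FreeMonoid.ofList u) 1 := by
    induction u with
    | nil => simp [word, MonoidAlgebra.one_def]
    | cons i u ih =>
      have : word (i :: u) = z i * word u := by simp [word]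
      rw [this, map_mul, ih, FreeMonoid.ofList_cons]
      simp [FreeAlgebra.equivMonoidAlgebraFreeMonoid, MonoidAlgebra.single_mul_single]
  rw [wordBasis, Module.Basis.reindex_apply]
  apply (FreeAlgebra.equivMonoidAlgebraFreeMonoid (R := Coeff) (X := ℕ+)).injective
  rw [h]
  simp [FreeAlgebra.basisFreeMonoid]

/-- The `ℚ[ℏ]`-linear endomorphism of `H1` with prescribed values on the words. -/
def linExt (f : List ℕ+ → H1) : H1 →ₗ[Coeff] H1 := wordBasis.constr Coeff f

theorem linExt_word (f : List ℕ+ → H1) (u : List ℕ+) : linExt f (word u) = f u := by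
  rw [← wordBasis_apply, linExt, Module.Basis.constr_basis]

/-- The submodule of non-constant elements, spanned by the non-empty words. -/
def H1pos : Submodule Coeff H1 := Submodule.span Coeff {w | ∃ u : List ℕ+, u ≠ [] ∧ w = word u}

/-- A word is admissible if it is empty or its first letter `z_{k₁}` has `k₁ ≥ 2`. -/
def Admissible (u : List ℕ+) : Prop := ∀ k ∈ u.head?, 2 ≤ k

/-- The submodule spanned by `1` and the words with `k₁ ≥ 2`. -/
def H0 : Submodule Coeff H1 := Submodule.span Coeff {w | ∃ u : List ℕ+, Admissible u ∧ w = word u}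

/-- The action `z_i ∘`, determined by `z_i ∘ 1 = 0` and `z_i ∘ (z_j w) = z_{i+j} w`. -/
def circ (i : ℕ+) : H1 →ₗ[Coeff] H1 :=
  linExt fun u => match u with
    | [] => 0
    | j :: v => z (i + j) * word v

/-- `z_i ∘₋ z_j = - z_{i+j} + ℏ z_{i+j-1}`. -/
def circMinus (i j : ℕ+) : H1 := -z (i + j) + hbar • z (i + j - 1)

/-- The product `*₋` of two words. -/
def starMinusWord : List ℕ+ → List ℕ+ → H1
  | [], v => word v
  | i :: u, [] => word (i :: u)
  | i :: u, j :: v =>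
      z i * starMinusWord u (j :: v) + z j * starMinusWord (i :: u) v
        + circMinus i j * starMinusWord u v
termination_by u v => u.length + v.length

/-- The `ℚ[ℏ]`-bilinear product `*₋` on `H1`. -/
def starMinus : H1 →ₗ[Coeff] H1 →ₗ[Coeff] H1 :=
  wordBasis.constr Coeff fun u => wordBasis.constr Coeff fun v => starMinusWord u v

/-- For `u = [k₁, …, k_r]`, the set `I_u = {k₁ + ⋯ + k_j | 1 ≤ j < r}`. -/
def partialSums (u : List ℕ+) : Finset ℕ :=
  (Finset.Ico 1 u.length).image fun j => ((u.take j).map (fun k : ℕ+ => (k : ℕ))).sum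

/-- The complement of `I_u` in `{1, …, k₁ + ⋯ + k_r}`. -/
def partialSumsCompl (u : List ℕ+) : Finset ℕ :=
  Finset.Icc 1 (u.map (fun k : ℕ+ => (k : ℕ))).sum \ partialSums u

/-- From `[p₁, …, p_l]` with `p < p₁ < ⋯ < p_l`, the list `[p₁ - p, p₂ - p₁, …, p_l - p_{l-1}]`.
(The differences are positive, so the conversion to `ℕ+` does not change them.) -/
def differences : ℕ → List ℕ → List ℕ+
  | _, [] => []
  | p, p' :: l => (p' - p).toPNat' :: differences p' l

/-- The word `φ(u)`: its letters are the successive differences of the elements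
`0 < p₁ < ⋯ < p_l` of the complement of `I_u`. -/
def phiWord (u : List ℕ+) : List ℕ+ := differences 0 ((partialSumsCompl u).sort)

/-- The `ℚ[ℏ]`-linear map `φ`. -/
def phi : H1 →ₗ[Coeff] H1 := linExt fun u => word (phiWord u)

/-- The `q`-integer `[n] = (1 - q^n) / (1 - q)` in `ℚ⟦q⟧`. -/
def qInt (n : ℕ) : ℚ⟦X⟧ := (1 - X ^ n) * (1 - X)⁻¹

/-- The index set `m₁ ≥ m₂ ≥ ⋯ ≥ m_r ≥ 1`. -/
abbrev StarIndex (r : ℕ) : Type := {m : Fin r → ℕ // Antitone m ∧ ∀ j, 1 ≤ m j}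

/-- The term
`q^{(k₁-1)m₁ + ⋯ + (k_r-1)m_r} / ([m₁]^{k₁} ⋯ [m_r]^{k_r})`. Each `[m_j]` with `m_j ≥ 1` has
constant coefficient `1`, so the inverse is the genuine one. -/
def starTerm (u : List ℕ+) (m : Fin u.length → ℕ) : ℚ⟦X⟧ :=
  ∏ j, X ^ (((u.get j : ℕ) - 1) * m j) * ((qInt (m j)) ^ (u.get j : ℕ))⁻¹

/-- The `q`-adic topology on `ℚ⟦q⟧`: the product topology for the discrete topology on the
coefficients. -/
abbrev qAdic : TopologicalSpace ℚ⟦X⟧ :=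
  @PowerSeries.WithPiTopology.instTopologicalSpace ℚ ⊥

/-- The sets `{f + g | v(g) ≥ n}` form a neighbourhood base at `f`. -/
theorem qAdic_nhds_basis (f : ℚ⟦X⟧) :
    (@nhds _ qAdic f).HasBasis (fun _ : ℕ => True) (fun n => {h | (n : ℕ∞) ≤ (h - f).order}) := by
  let _ : TopologicalSpace ℚ := ⊥
  let _ : TopologicalSpace ℚ⟦X⟧ := qAdic
  have : DiscreteTopology ℚ := ⟨rfl⟩
  have key : ∀ (n : ℕ) (h : ℚ⟦X⟧),
      (n : ℕ∞) ≤ (h - f).order ↔ ∀ i < n, coeff i h = coeff i f := by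
    intro n h
    constructor
    · intro hn i hi
      have := coeff_of_lt_order i (lt_of_lt_of_le (Nat.cast_lt.mpr hi) hn)
      rwa [map_sub, sub_eq_zero] at this
    · intro hn
      apply le_order
      intro i hi
      rw [map_sub, sub_eq_zero]
      exact hn i (Nat.cast_lt.mp hi)
  refine ⟨fun t => ⟨fun ht => ?_, ?_⟩⟩
  · by_contra! hcon
    have hex : ∀ n : ℕ, ∃ h : ℚ⟦X⟧, (n : ℕ∞) ≤ (h - f).order ∧ h ∉ t := fun n => by
      simpa [Set.not_subset] using hcon n
    choose g hg hgt using hex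
    have hlim : Filter.Tendsto g Filter.atTop (@nhds _ qAdic f) := by
      rw [WithPiTopology.tendsto_iff_coeff_tendsto]
      intro d
      apply tendsto_const_nhds.congr'
      filter_upwards [Filter.eventually_gt_atTop d] with n hn
      exact ((key n (g n)).mp (hg n) d hn).symm
    obtain ⟨n, hn⟩ := (hlim.eventually ht).exists
    exact hgt n hn
  · rintro ⟨n, -, hn⟩
    refine Filter.mem_of_superset ?_ hn
    have : {h : ℚ⟦X⟧ | (n : ℕ∞) ≤ (h - f).order} =
        ⋂ i ∈ Finset.range n, (fun h : ℚ⟦X⟧ => coeff i h) ⁻¹' {coeff i f} := by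
      ext h
      simp [key]
    rw [this, Filter.biInter_finset_mem]
    intro i _
    exact ((isOpen_discrete _).preimage (WithPiTopology.continuous_coeff ℚ i)).mem_nhds rfl

/-- The `q`-analogue of the multiple zeta star value of an admissible word,
`∑_{m₁ ≥ ⋯ ≥ m_r ≥ 1} q^{(k₁-1)m₁ + ⋯ + (k_r-1)m_r} / ([m₁]^{k₁} ⋯ [m_r]^{k_r})`. -/
def zetaStarWord (u : List ℕ+) : ℚ⟦X⟧ :=
  letI := qAdic
  ∑' m : StarIndex u.length, starTerm u m.1

/-- For an admissible word the defining series converges. -/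
theorem summable_starTerm (u : List ℕ+) (hu : Admissible u) :
    @Summable _ _ _ qAdic (fun m : StarIndex u.length => starTerm u m.1)
      (SummationFilter.unconditional _) := by
  let _ : TopologicalSpace ℚ := ⊥
  rw [WithPiTopology.summable_iff_summable_coeff]
  intro d
  apply summable_of_hasFiniteSupport
  match u, hu with
  | [], _ =>
    have : Subsingleton (StarIndex ([] : List ℕ+).length) :=
      ⟨fun a b => Subtype.ext (funext fun j => Fin.elim0 j)⟩
    exact Set.toFinite _
  | k :: v, hu =>
    have hk : 2 ≤ (k : ℕ) := by
      have : (2 : ℕ+) ≤ k := hu k (by simp)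
      exact_mod_cast this
    have hfin : ((fun m : StarIndex (k :: v).length => m.1) ⁻¹'
        (Set.pi Set.univ fun _ => Set.Iic d)).Finite :=
      (Set.Finite.pi fun _ => Set.finite_Iic d).preimage Subtype.val_injective.injOn
    refine hfin.subset ?_
    intro m hm j _
    by_contra hj
    apply hm
    have h0 : d < m.1 ⟨0, by simp⟩ :=
      lt_of_lt_of_le (not_le.mp hj) (m.2.1 (Fin.mk_le_of_le_val (Nat.zero_le _)))
    have hdvd : (X : ℚ⟦X⟧) ^ (d + 1) ∣ starTerm (k :: v) m.1 := by
      refine dvd_trans (dvd_trans (pow_dvd_pow X ?_) (Dvd.intro _ rfl))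
        (Finset.dvd_prod_of_mem _ (Finset.mem_univ (⟨0, by simp⟩ : Fin (k :: v).length)))
      have : 1 ≤ (k : ℕ) - 1 := by omega
      calc d + 1 ≤ 1 * m.1 ⟨0, by simp⟩ := by omega
        _ ≤ _ := Nat.mul_le_mul_right _ this
    exact X_pow_dvd_iff.mp hdvd d (Nat.lt_succ_self d)

/-- The action of `ℚ[ℏ]` on `ℚ⟦q⟧`: `ℏ` acts as multiplication by `1 - q`. -/
def evalHbar : Coeff →ₐ[ℚ] ℚ⟦X⟧ := Polynomial.aeval (1 - X : ℚ⟦X⟧)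

/-- The `ℚ[ℏ]`-linear extension of `zetaStarWord`; meaningful on `H0`. -/
def zetaStar (w : H1) : ℚ⟦X⟧ :=
  (wordBasis.repr w).sum fun u c => evalHbar c * zetaStarWord u

end QMZV

end

/-! This is a `q`-analogue of Kawashima's relation, proved by interpolation. For a word `u` let
`S_u(N)` be the sum over `N ≥ m₁ ≥ ⋯ ≥ m_r ≥ 1` of the products of the `q^{m_j}/[m_j]^{k_j}`. Since
`1 - q^m = (1-q)[m]`, multiplying two such weights reproduces the correction term of `*₋` with `ℏ =
1-q`, so `w ↦ S_w(N)` is multiplicative for `*₋` (`wordExt_starMinus`).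

A duality by `q`-binomial transforms (`nestedSum_dualWeight`) expands `S_u(N)` as a Newton series in
`x = q^N` with nodes `1, q, q², …`. Its `n`-th coefficient is, up to sign, `q^n/((1-q)⋯(1-q^n))`
times the part of the star sum of `φ(u)` with largest index `n`. These coefficients tend to zero
`q`-adically, so modulo `q^K` the series is a polynomial of bounded degree in `x`. The identity
`S_{w₁} S_{w₂} = S_{w₁ *₋ w₂}` at enough points `q^N` therefore becomes a polynomial identity modulo
`q^K` (`C_X_pow_dvd_newtonPoly`).

For non-constant `w₁, w₂` both factors vanish at `x = 1`, hence the derivative of the product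
vanishes there modulo `q^K`. Up to the factor `-(1-q)`, that derivative is the star value of `z₁ ∘
φ(w₁ *₋ w₂)` (`one_sub_X_mul_newtonSlope`), and `K` is arbitrary. -/

noncomputable section

namespace QMZV

/-! ### Inverses of `q`-integers -/

/-- The inverse `1 / [m]` of the `q`-integer. -/
def qIntInv (m : ℕ) : ℚ⟦X⟧ := (qInt m)⁻¹

theorem one_sub_X_mul_inv : (1 - X : ℚ⟦X⟧) * (1 - X)⁻¹ = 1 :=
  PowerSeries.mul_inv_cancel _ (by simp)

theorem constantCoeff_qInt {m : ℕ} (hm : m ≠ 0) : constantCoeff (qInt m) ≠ 0 := by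
  simp [qInt, hm]

theorem qInt_mul_qIntInv {m : ℕ} (hm : m ≠ 0) : qInt m * qIntInv m = 1 :=
  PowerSeries.mul_inv_cancel _ (constantCoeff_qInt hm)

theorem one_sub_X_mul_qInt (m : ℕ) : (1 - X) * qInt m = 1 - X ^ m := by
  rw [qInt, mul_left_comm, one_sub_X_mul_inv, mul_one]

theorem one_sub_X_pow_mul_qIntInv {m : ℕ} (hm : m ≠ 0) : (1 - X ^ m) * qIntInv m = 1 - X := by
  rw [← one_sub_X_mul_qInt, mul_assoc, qInt_mul_qIntInv hm, mul_one]

theorem inv_qInt_pow {m : ℕ} (hm : m ≠ 0) (k : ℕ) : ((qInt m) ^ k)⁻¹ = qIntInv m ^ k := by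
  rw [PowerSeries.inv_eq_iff_mul_eq_one (by simpa using pow_ne_zero k (constantCoeff_qInt hm)),
    mul_comm, ← mul_pow, qInt_mul_qIntInv hm, one_pow]

/-! ### Linear extension of functions on words -/

/-- The extension to `H1` of a function on words with values in `ℚ⟦q⟧`, where `ℏ` acts as
`1 - q`. -/
def wordExt (f : List ℕ+ → ℚ⟦X⟧) (w : H1) : ℚ⟦X⟧ :=
  (wordBasis.repr w).sum fun u c => evalHbar c * f u

theorem zetaStar_eq_wordExt (w : H1) : zetaStar w = wordExt zetaStarWord w := rfl

theorem wordExt_add (f : List ℕ+ → ℚ⟦X⟧) (w w' : H1) :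
    wordExt f (w + w') = wordExt f w + wordExt f w' := by
  unfold wordExt
  rw [map_add, Finsupp.sum_add_index']
  · simp
  · intros; rw [map_add, add_mul]

theorem wordExt_smul (f : List ℕ+ → ℚ⟦X⟧) (c : Coeff) (w : H1) :
    wordExt f (c • w) = evalHbar c * wordExt f w := by
  unfold wordExt
  rw [map_smul, Finsupp.sum_smul_index' (by simp), Finsupp.sum, Finsupp.sum, Finset.mul_sum]
  simp [mul_assoc]

theorem wordExt_word (f : List ℕ+ → ℚ⟦X⟧) (u : List ℕ+) : wordExt f (word u) = f u := by
  unfold wordExt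
  rw [← wordBasis_apply, Module.Basis.repr_self, Finsupp.sum_single_index] <;> simp

theorem wordExt_zero (f : List ℕ+ → ℚ⟦X⟧) : wordExt f 0 = 0 := by
  simp [wordExt]

theorem wordExt_neg (f : List ℕ+ → ℚ⟦X⟧) (w : H1) : wordExt f (-w) = -wordExt f w := by
  rw [show -w = (-1 : Coeff) • w from (neg_one_smul Coeff w).symm, wordExt_smul, map_neg, map_one,
    neg_one_mul]

theorem evalHbar_hbar : evalHbar hbar = 1 - X := by
  simp [evalHbar]

/-- A property of elements of `H1` compatible with linear combinations holds if it holds on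
words. -/
theorem word_induction {p : H1 → Prop} (hw : ∀ u, p (word u)) (h0 : p 0)
    (ha : ∀ x y, p x → p y → p (x + y)) (hs : ∀ (c : Coeff) x, p x → p (c • x)) (w : H1) : p w := by
  have : w ∈ Submodule.span Coeff (Set.range wordBasis) := by
    rw [wordBasis.span_eq]; trivial
  induction this using Submodule.span_induction with
  | mem x hx => obtain ⟨u, rfl⟩ := hx; rw [wordBasis_apply]; exact hw u
  | zero => exact h0
  | add x y _ _ hx hy => exact ha x y hx hy
  | smul c x _ hx => exact hs c x hx

theorem word_cons (i : ℕ+) (u : List ℕ+) : word (i :: u) = z i * word u := by simp [word]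

/-! ### Nested sums -/

/-- `∑_{N ≥ m₁ ≥ ⋯ ≥ m_r ≥ 1} ∏ g (k_j, m_j)` for the word `z_{k₁} ⋯ z_{k_r}`. -/
def nestedSum (g : ℕ+ → ℕ → ℚ⟦X⟧) : List ℕ+ → ℕ → ℚ⟦X⟧
  | [], _ => 1
  | k :: u, N => ∑ m ∈ Finset.range N, g k (m + 1) * nestedSum g u (m + 1)

/-- `q^m / [m]^k`. -/
def dualWeight (k : ℕ+) (m : ℕ) : ℚ⟦X⟧ := X ^ m * qIntInv m ^ (k : ℕ)

/-- `q^{(k-1)m} / [m]^k`. -/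
def starWeight (k : ℕ+) (m : ℕ) : ℚ⟦X⟧ := X ^ (((k : ℕ) - 1) * m) * qIntInv m ^ (k : ℕ)

theorem wordExt_z_mul (g : ℕ+ → ℕ → ℚ⟦X⟧) (i : ℕ+) (w : H1) (N : ℕ) :
    wordExt (nestedSum g · N) (z i * w) =
      ∑ m ∈ Finset.range N, g i (m + 1) * wordExt (nestedSum g · (m + 1)) w := by
  induction w using word_induction with
  | hw u => simp only [← word_cons, wordExt_word, nestedSum]
  | h0 => simp [wordExt_zero]
  | ha x y hx hy => simp only [mul_add, wordExt_add, hx, hy, Finset.sum_add_distrib]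
  | hs c x hx =>
    simp only [mul_smul_comm, wordExt_smul, hx, Finset.mul_sum]
    exact Finset.sum_congr rfl fun _ _ => by ring

/-- Write `q^{2m} = q^m - q^m(1 - q^m)` and cancel one factor `[m]` in the last term. This is the
source of `-z_{i+j} + ℏ z_{i+j-1}`. -/
theorem dualWeight_mul (i j : ℕ+) (m : ℕ) :
    dualWeight i (m + 1) * dualWeight j (m + 1) =
      dualWeight (i + j) (m + 1) - (1 - X) * dualWeight (i + j - 1) (m + 1) := by
  have h1 : ((i + j - 1 : ℕ+) : ℕ) + 1 = i + j := by
    have : (1 : ℕ+) < i + j := by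
      rw [← PNat.coe_lt_coe]; have := i.pos; have := j.pos; push_cast; omega
    have := PNat.sub_coe (i + j) 1
    rw [if_pos ‹_›] at this
    have := i.pos; have := j.pos; push_cast at *; omega
  unfold dualWeight
  rw [PNat.add_coe, ← h1, ← one_sub_X_pow_mul_qIntInv (m := m + 1) (by omega),
    show ∀ a b c d : ℚ⟦X⟧, a * b * (c * d) = a * c * (b * d) by intros; ring, ← pow_add, ← pow_add,
    ← h1]
  ring

theorem wordExt_circMinus_mul (i j : ℕ+) (w : H1) (N : ℕ) :
    wordExt (nestedSum dualWeight · N) (circMinus i j * w) =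
      -∑ m ∈ Finset.range N, dualWeight i (m + 1) * dualWeight j (m + 1) *
        wordExt (nestedSum dualWeight · (m + 1)) w := by
  rw [circMinus, add_mul, show -z (i + j) * w = -(z (i + j) * w) from neg_mul (z (i + j)) w,
    smul_mul_assoc, wordExt_add, wordExt_neg, wordExt_smul,
    wordExt_z_mul, wordExt_z_mul, evalHbar_hbar, Finset.mul_sum, ← Finset.sum_neg_distrib,
    ← Finset.sum_neg_distrib, ← Finset.sum_add_distrib]
  refine Finset.sum_congr rfl fun m _ => ?_
  rw [dualWeight_mul]
  ring

/-- The square of index pairs is split by which index is larger; the diagonal is counted twice and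
so subtracted once. This mirrors the three terms of the recursion for `*₋`. -/
theorem sum_range_mul_sum_range {R : Type*} [CommRing R] (a b : ℕ → R) (N : ℕ) :
    (∑ m ∈ Finset.range N, a m) * ∑ m ∈ Finset.range N, b m =
      ∑ m ∈ Finset.range N, (a m * ∑ l ∈ Finset.range (m + 1), b l +
        b m * ∑ l ∈ Finset.range (m + 1), a l - a m * b m) := by
  induction N with
  | zero => simp
  | succ N ih =>
    rw [Finset.sum_range_succ (n := N), Finset.sum_range_succ (n := N),
      Finset.sum_range_succ (n := N), ← ih, Finset.sum_range_succ (n := N),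
      Finset.sum_range_succ (n := N)]
    ring

theorem wordExt_starMinusWord (u v : List ℕ+) (N : ℕ) :
    wordExt (nestedSum dualWeight · N) (starMinusWord u v) =
      nestedSum dualWeight u N * nestedSum dualWeight v N := by
  induction u, v using starMinusWord.induct generalizing N with
  | case1 v => simp [starMinusWord, wordExt_word, nestedSum]
  | case2 i u => simp [starMinusWord, wordExt_word, nestedSum]
  | case3 i u j v ih1 ih2 ih3 =>
    rw [starMinusWord, wordExt_add, wordExt_add, wordExt_z_mul, wordExt_z_mul,
      wordExt_circMinus_mul, ← sub_eq_add_neg, ← Finset.sum_add_distrib, ← Finset.sum_sub_distrib]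
    simp only [nestedSum]
    rw [sum_range_mul_sum_range]
    refine Finset.sum_congr rfl fun m _ => ?_
    rw [ih1, ih2, ih3]
    simp only [nestedSum]
    ring

theorem starMinus_word (u v : List ℕ+) : starMinus (word u) (word v) = starMinusWord u v := by
  rw [← wordBasis_apply, ← wordBasis_apply, starMinus, Module.Basis.constr_basis,
    Module.Basis.constr_basis]

theorem wordExt_starMinus (w w' : H1) (N : ℕ) :
    wordExt (nestedSum dualWeight · N) (starMinus w w') =
      wordExt (nestedSum dualWeight · N) w * wordExt (nestedSum dualWeight · N) w' := by
  induction w using word_induction with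
  | h0 => simp [wordExt_zero]
  | ha x y hx hy => rw [map_add, LinearMap.add_apply, wordExt_add, wordExt_add, hx, hy, add_mul]
  | hs c x hx => rw [map_smul, LinearMap.smul_apply, wordExt_smul, wordExt_smul, hx, mul_assoc]
  | hw u =>
    induction w' using word_induction with
    | h0 => simp [wordExt_zero]
    | ha x y hx hy => rw [map_add, wordExt_add, wordExt_add, hx, hy, mul_add]
    | hs c x hx => rw [map_smul, wordExt_smul, wordExt_smul, hx]; ring
    | hw v => rw [starMinus_word, wordExt_starMinusWord, wordExt_word, wordExt_word]

/-! ### `q`-binomial transforms -/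

/-- `∏_{1 ≤ j ≤ n} (1 - q^j)`. -/
def qPoch (n : ℕ) : ℚ⟦X⟧ := ∏ j ∈ Finset.range n, (1 - X ^ (j + 1))

theorem constantCoeff_qPoch (n : ℕ) : constantCoeff (qPoch n) ≠ 0 := by
  simp [qPoch, map_prod]

theorem qPoch_mul_inv (n : ℕ) : qPoch n * (qPoch n)⁻¹ = 1 :=
  PowerSeries.mul_inv_cancel _ (constantCoeff_qPoch n)

theorem qPoch_succ (n : ℕ) : qPoch (n + 1) = qPoch n * (1 - X ^ (n + 1)) :=
  Finset.prod_range_succ _ _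

theorem inv_qPoch_succ (n : ℕ) : (1 - X ^ (n + 1)) * (qPoch (n + 1))⁻¹ = (qPoch n)⁻¹ := by
  have h1 := qPoch_mul_inv n
  have h2 := qPoch_mul_inv (n + 1)
  rw [qPoch_succ] at h2 ⊢
  linear_combination (qPoch n)⁻¹ * h2 - (1 - X ^ (n + 1)) * (qPoch n * (1 - X ^ (n + 1)))⁻¹ * h1

/-- `∏_{0 ≤ j < n} (q^j - q^N)`. -/
def newtonNode (N n : ℕ) : ℚ⟦X⟧ := ∏ j ∈ Finset.range n, (X ^ j - X ^ N)

theorem newtonNode_succ (N n : ℕ) : newtonNode N (n + 1) = newtonNode N n * (X ^ n - X ^ N) :=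
  Finset.prod_range_succ _ _

theorem newtonNode_succ_succ (N n : ℕ) :
    newtonNode (N + 1) (n + 1) = (1 - X ^ (N + 1)) * X ^ n * newtonNode N n := by
  have : newtonNode (N + 1) (n + 1) =
      (∏ j ∈ Finset.range n, X * (X ^ j - X ^ N)) * (1 - X ^ (N + 1)) := by
    rw [newtonNode, Finset.prod_range_succ', pow_zero]
    congr 1
    exact Finset.prod_congr rfl fun j _ => by ring
  rw [this, Finset.prod_mul_distrib, Finset.prod_const, Finset.card_range, newtonNode]
  ring

theorem newtonNode_eq_zero {N n : ℕ} (h : N < n) : newtonNode N n = 0 :=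
  Finset.prod_eq_zero (Finset.mem_range.mpr h) (sub_self _)

/-- The `q`-binomial coefficient of `N` and `n` times `q^{n(n-1)/2}`. -/
def qBinom (N n : ℕ) : ℚ⟦X⟧ := newtonNode N n * (qPoch n)⁻¹

theorem qBinom_eq_zero {N n : ℕ} (h : N < n) : qBinom N n = 0 := by
  rw [qBinom, newtonNode_eq_zero h, zero_mul]

theorem qBinom_zero_right (N : ℕ) : qBinom N 0 = 1 := by
  simp [qBinom, newtonNode, qPoch]

theorem qBinom_succ_succ (N n : ℕ) :
    qBinom (N + 1) (n + 1) = qBinom N (n + 1) + X ^ N * qBinom N n := by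
  rw [qBinom, qBinom, qBinom, newtonNode_succ_succ, newtonNode_succ, ← inv_qPoch_succ n]
  ring

theorem qBinom_succ_succ' (N n : ℕ) :
    qBinom (N + 1) (n + 1) = X ^ (n + 1) * qBinom N (n + 1) + X ^ n * qBinom N n := by
  rw [qBinom, qBinom, qBinom, newtonNode_succ_succ, newtonNode_succ, ← inv_qPoch_succ n]
  ring

/-- The absorption identity for `q`-binomials: it moves a denominator `[n+1]` out of the sum over
`n`, turning it into `[N+1]`. -/
theorem qIntInv_mul_qBinom (N n : ℕ) :
    X ^ n * qBinom N n * qIntInv (n + 1) = qIntInv (N + 1) * qBinom (N + 1) (n + 1) := by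
  have h1 := one_sub_X_pow_mul_qIntInv (m := n + 1) (by omega)
  have h2 := one_sub_X_pow_mul_qIntInv (m := N + 1) (by omega)
  rw [qBinom, qBinom, newtonNode_succ_succ, ← inv_qPoch_succ n]
  linear_combination X ^ n * newtonNode N n * (qPoch (n + 1))⁻¹ * (h1 - h2)

/-- `∑_{n ≥ 1} (-1)^{n-1} q^{n(n+1)/2} (N choose n)_q c_n`, where `c n` stands for `c_{n+1}`. -/
def binomTransform (c : ℕ → ℚ⟦X⟧) (N : ℕ) : ℚ⟦X⟧ :=
  ∑ n ∈ Finset.range N, (-1) ^ n * X ^ (n + 1) * qBinom N (n + 1) * c n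

/-- `∑_{n ≥ 1} (-1)^{n-1} q^{n(n-1)/2} (N choose n-1)_q c_n`, where `c n` stands for `c_{n+1}`. -/
def binomTransform' (c : ℕ → ℚ⟦X⟧) (N : ℕ) : ℚ⟦X⟧ :=
  ∑ n ∈ Finset.range (N + 1), (-1) ^ n * X ^ n * qBinom N n * c n

theorem binomTransform_succ (c : ℕ → ℚ⟦X⟧) (N : ℕ) :
    binomTransform c (N + 1) = binomTransform c N + X ^ (N + 1) * binomTransform' c N := by
  -- One more summand is added, which vanishes because `n + 1 > N`, so that all sums have the same
  -- range.
  have : binomTransform c N =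
      ∑ n ∈ Finset.range (N + 1), (-1) ^ n * X ^ (n + 1) * qBinom N (n + 1) * c n := by
    rw [Finset.sum_range_succ, qBinom_eq_zero (Nat.lt_succ_self N)]
    simp [binomTransform]
  rw [this, binomTransform, binomTransform', Finset.mul_sum, ← Finset.sum_add_distrib]
  refine Finset.sum_congr rfl fun n _ => ?_
  rw [qBinom_succ_succ]
  ring

theorem binomTransform_eq_sum (c : ℕ → ℚ⟦X⟧) (N : ℕ) :
    binomTransform c N = ∑ m ∈ Finset.range N, X ^ (m + 1) * binomTransform' c m := by
  induction N with
  | zero => simp [binomTransform]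
  | succ N ih => rw [binomTransform_succ, Finset.sum_range_succ, ih]

theorem binomTransform'_one (N : ℕ) : binomTransform' (fun n => qIntInv (n + 1)) N =
    qIntInv (N + 1) := by
  -- By the second Pascal rule the alternating sum telescopes, leaving only the boundary term at `n
  -- = 0`.
  have h : ∀ N : ℕ, ∑ n ∈ Finset.range (N + 1), (-1) ^ n * qBinom (N + 1) (n + 1) = 1 := by
    intro N
    have h1 : ∀ n, (-1) ^ n * qBinom (N + 1) (n + 1) =
        (-1) ^ n * X ^ n * qBinom N n - (-1) ^ (n + 1) * X ^ (n + 1) * qBinom N (n + 1) := by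
      intro n
      rw [qBinom_succ_succ']
      ring
    simp only [h1]
    rw [Finset.sum_range_sub' (fun n => (-1) ^ n * X ^ n * qBinom N n),
      qBinom_eq_zero (Nat.lt_succ_self N), qBinom_zero_right]
    simp
  rw [← mul_one (qIntInv (N + 1)), ← h N, Finset.mul_sum]
  refine Finset.sum_congr rfl fun n _ => ?_
  linear_combination (-1) ^ n * qIntInv_mul_qBinom N n

/-- Absorption followed by summation by parts: the Pascal rule splits each term into the wanted one
and a telescoping difference. Its lower end is an empty partial sum, its upper end a `q`-binomial
with `n > N`. -/
theorem binomTransform'_sum (c : ℕ → ℚ⟦X⟧) (N : ℕ) :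
    binomTransform' (fun n => qIntInv (n + 1) * ∑ m ∈ Finset.range (n + 1), c m) N =
      qIntInv (N + 1) * binomTransform' c N := by
  have h1 : ∀ n, (-1) ^ n * X ^ n * qBinom N n *
      (qIntInv (n + 1) * ∑ m ∈ Finset.range (n + 1), c m) =
      qIntInv (N + 1) * ((-1) ^ n * X ^ n * qBinom N n * c n +
        ((-1) ^ n * X ^ n * qBinom N n * ∑ m ∈ Finset.range n, c m -
          (-1) ^ (n + 1) * X ^ (n + 1) * qBinom N (n + 1) * ∑ m ∈ Finset.range (n + 1), c m)) := by
    intro n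
    have := qIntInv_mul_qBinom N n
    rw [qBinom_succ_succ'] at this
    have h2 : ∑ m ∈ Finset.range (n + 1), c m = ∑ m ∈ Finset.range n, c m + c n :=
      Finset.sum_range_succ _ _
    linear_combination (-1) ^ n * (∑ m ∈ Finset.range (n + 1), c m) * this +
      qIntInv (N + 1) * (-1) ^ n * X ^ n * qBinom N n * h2
  rw [binomTransform', binomTransform', Finset.mul_sum]
  simp only [h1, ← Finset.mul_sum]
  rw [Finset.sum_add_distrib, Finset.sum_range_sub' (fun n => (-1) ^ n * X ^ n * qBinom N n *
    ∑ m ∈ Finset.range n, c m), qBinom_eq_zero (Nat.lt_succ_self N)]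
  simp

theorem binomTransform'_mul (c : ℕ → ℚ⟦X⟧) (N : ℕ) :
    binomTransform' (fun n => X ^ (n + 1) * qIntInv (n + 1) * c n) N =
      qIntInv (N + 1) * binomTransform c (N + 1) := by
  rw [binomTransform, binomTransform', Finset.mul_sum]
  refine Finset.sum_congr rfl fun n _ => ?_
  linear_combination (-1) ^ n * X ^ (n + 1) * c n * qIntInv_mul_qBinom N n

/-! ### The combinatorial duality `φ` -/

theorem differences_map_succ (p : ℕ) (l : List ℕ) :
    differences (p + 1) (l.map (· + 1)) = differences p l := by
  induction l generalizing p with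
  | nil => rfl
  | cons a l ih => simp [differences, ih]

theorem sort_map_succ (s : Finset ℕ) :
    (s.map (addRightEmbedding 1)).sort = s.sort.map (· + 1) :=
  (Finset.map_sort _ _ _ _ fun a _ b _ => by simp).symm

theorem mem_partialSums {u : List ℕ+} {p : ℕ} : p ∈ partialSums u ↔
    ∃ j, 1 ≤ j ∧ j < u.length ∧ ((u.take j).map (fun k : ℕ+ => (k : ℕ))).sum = p := by
  simp [partialSums, and_assoc]

theorem partialSums_succ_cons (k : ℕ+) (u : List ℕ+) :
    partialSums ((k + 1) :: u) = (partialSums (k :: u)).map (addRightEmbedding 1) := by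
  ext p
  simp only [mem_partialSums, Finset.mem_map, addRightEmbedding_apply]
  constructor
  · rintro ⟨j, h1, h2, rfl⟩
    refine ⟨_, ⟨j, h1, h2, rfl⟩, ?_⟩
    obtain ⟨j, rfl⟩ := Nat.exists_eq_add_of_le' h1
    simp; ring
  · rintro ⟨_, ⟨j, h1, h2, rfl⟩, rfl⟩
    refine ⟨j, h1, h2, ?_⟩
    obtain ⟨j, rfl⟩ := Nat.exists_eq_add_of_le' h1
    simp; ring

theorem partialSums_one_cons_cons (k : ℕ+) (u : List ℕ+) :
    partialSums (1 :: k :: u) =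
      insert 1 ((partialSums (k :: u)).map (addRightEmbedding 1)) := by
  ext p
  simp only [mem_partialSums, Finset.mem_map, addRightEmbedding_apply, Finset.mem_insert]
  constructor
  · rintro ⟨j, h1, h2, rfl⟩
    obtain ⟨j, rfl⟩ := Nat.exists_eq_add_of_le' h1
    rcases Nat.eq_zero_or_pos j with rfl | hj
    · left; simp
    · right
      refine ⟨_, ⟨j, hj, by simpa using h2, rfl⟩, ?_⟩
      simp; ring
  · rintro (rfl | ⟨_, ⟨j, h1, h2, rfl⟩, rfl⟩)
    · exact ⟨1, le_rfl, by simp, by simp⟩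
    · refine ⟨j + 1, by omega, by simpa using h2, ?_⟩
      simp; ring

theorem pos_of_mem_partialSums {u : List ℕ+} {p : ℕ} (hp : p ∈ partialSums u) : 1 ≤ p := by
  obtain ⟨j, h1, h2, rfl⟩ := mem_partialSums.mp hp
  obtain ⟨j, rfl⟩ := Nat.exists_eq_add_of_le' h1
  cases u with
  | nil => simp at h2
  | cons k u => have := k.pos; simp; omega

theorem partialSumsCompl_succ_cons (k : ℕ+) (u : List ℕ+) :
    partialSumsCompl ((k + 1) :: u) =
      insert 1 ((partialSumsCompl (k :: u)).map (addRightEmbedding 1)) := by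
  ext p
  have h0 : 0 ∉ partialSums (k :: u) := fun h => by simpa using pos_of_mem_partialSums h
  simp only [partialSumsCompl, partialSums_succ_cons, Finset.mem_sdiff, Finset.mem_Icc,
    Finset.mem_insert, Finset.mem_map, addRightEmbedding_apply, List.map_cons, List.sum_cons,
    PNat.add_coe, PNat.one_coe]
  constructor
  · rintro ⟨⟨h1, h2⟩, h3⟩
    rcases eq_or_ne p 1 with rfl | hp
    · exact Or.inl rfl
    · obtain ⟨p, rfl⟩ := Nat.exists_eq_add_of_le' h1
      exact Or.inr ⟨p, ⟨⟨by omega, by omega⟩, fun h => h3 ⟨p, h, rfl⟩⟩, rfl⟩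
  · rintro (rfl | ⟨p, ⟨⟨h1, h2⟩, h3⟩, rfl⟩)
    · refine ⟨⟨le_rfl, by omega⟩, ?_⟩
      rintro ⟨a, ha, h⟩
      obtain rfl : a = 0 := by omega
      exact h0 ha
    · refine ⟨⟨by omega, by omega⟩, ?_⟩
      rintro ⟨a, ha, h⟩
      obtain rfl : a = p := by omega
      exact h3 ha

theorem partialSumsCompl_one_cons_cons (k : ℕ+) (u : List ℕ+) :
    partialSumsCompl (1 :: k :: u) =
      (partialSumsCompl (k :: u)).map (addRightEmbedding 1) := by
  ext p
  simp only [partialSumsCompl, partialSums_one_cons_cons, Finset.mem_sdiff, Finset.mem_Icc,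
    Finset.mem_insert, Finset.mem_map, addRightEmbedding_apply, List.map_cons, List.sum_cons,
    PNat.one_coe, not_or]
  constructor
  · rintro ⟨⟨h1, h2⟩, h4, h3⟩
    obtain ⟨p, rfl⟩ := Nat.exists_eq_add_of_le' h1
    exact ⟨p, ⟨⟨by omega, by omega⟩, fun h => h3 ⟨p, h, rfl⟩⟩, rfl⟩
  · rintro ⟨p, ⟨⟨h1, h2⟩, h3⟩, rfl⟩
    refine ⟨⟨by omega, by omega⟩, by omega, ?_⟩
    rintro ⟨a, ha, h⟩
    obtain rfl : a = p := by omega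
    exact h3 ha

theorem pos_of_mem_partialSumsCompl {u : List ℕ+} {p : ℕ} (hp : p ∈ partialSumsCompl u) :
    1 ≤ p :=
  (Finset.mem_Icc.mp (Finset.mem_sdiff.mp hp).1).1

theorem phiWord_nil : phiWord [] = [] := by
  simp [phiWord, partialSumsCompl, differences]

theorem phiWord_one : phiWord [1] = [1] := by
  have : partialSumsCompl [1] = {1} := by
    simp [partialSumsCompl, partialSums]
  rw [phiWord, this, Finset.sort_singleton]
  rfl

/-- Raising the first letter shifts `I_u` by one, so `1` becomes a new smallest element of the
complement, and the other differences are unchanged. -/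
theorem phiWord_succ_cons (k : ℕ+) (u : List ℕ+) :
    phiWord ((k + 1) :: u) = 1 :: phiWord (k :: u) := by
  rw [phiWord, partialSumsCompl_succ_cons, Finset.sort_insert, sort_map_succ]
  · simp only [differences]
    rw [show (1 : ℕ) = 0 + 1 from rfl, differences_map_succ]
    rfl
  · simp
  · intro h
    obtain ⟨p, hp, h⟩ := Finset.mem_map.mp h
    have := pos_of_mem_partialSumsCompl hp
    simp at h
    omega

/-- Prepending `z₁` puts `1` into `I_u` and shifts the rest, so the complement is merely translated;
only its first difference, measured from `0`, grows. -/
theorem phiWord_one_cons_cons (k : ℕ+) (u : List ℕ+) {j : ℕ+} {v : List ℕ+}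
    (h : phiWord (k :: u) = j :: v) : phiWord (1 :: k :: u) = (1 + j) :: v := by
  rw [phiWord, partialSumsCompl_one_cons_cons, sort_map_succ]
  have hpos : ∀ p ∈ (partialSumsCompl (k :: u)).sort, 1 ≤ p := fun p hp =>
    pos_of_mem_partialSumsCompl ((Finset.mem_sort _).mp hp)
  rw [phiWord] at h
  cases hl : (partialSumsCompl (k :: u)).sort with
  | nil => simp [hl, differences] at h
  | cons p l =>
    rw [hl] at h hpos
    simp only [differences, List.cons.injEq, List.map_cons] at h ⊢
    rw [differences_map_succ]
    refine ⟨?_, h.2⟩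
    rw [← h.1, ← PNat.coe_inj]
    have := hpos p (by simp)
    simp only [PNat.add_coe, PNat.one_coe, Nat.toPNat'_coe]
    split_ifs <;> omega

theorem phiWord_ne_nil (k : ℕ+) (u : List ℕ+) : phiWord (k :: u) ≠ [] := by
  induction u generalizing k with
  | nil =>
    induction k using PNat.recOn with
    | one => simp [phiWord_one]
    | succ k _ => simp [phiWord_succ_cons]
  | cons k' u ih =>
    induction k using PNat.recOn with
    | one =>
      obtain ⟨j, v, h⟩ := List.exists_cons_of_ne_nil (ih k')
      simp [phiWord_one_cons_cons k' u h]
    | succ k _ => simp [phiWord_succ_cons]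

/-! ### Duality for nested sums -/

/-- The part of the nested sum with weights `q^{(k-1)m} / [m]^k` in which the largest summation
index equals `n`. -/
def starLeading : List ℕ+ → ℕ → ℚ⟦X⟧
  | [], _ => 0
  | k :: u, n => starWeight k n * nestedSum starWeight u n

theorem starWeight_one (n : ℕ) : starWeight 1 n = qIntInv n := by simp [starWeight]

theorem starWeight_one_add (k : ℕ+) (n : ℕ) :
    starWeight (1 + k) n = X ^ n * qIntInv n * starWeight k n := by
  have := k.pos
  obtain ⟨k', hk⟩ := Nat.exists_eq_add_of_le' this
  simp only [starWeight, PNat.add_coe, PNat.one_coe, hk]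
  rw [show 1 + (k' + 1) - 1 = k' + 1 by omega, show k' + 1 - 1 = k' by omega]
  ring

theorem starLeading_one_cons {u : List ℕ+} (hu : u ≠ []) (n : ℕ) :
    starLeading (1 :: u) n =
      qIntInv n * ∑ m ∈ Finset.range n, starLeading u (m + 1) := by
  obtain ⟨k, v, rfl⟩ := List.exists_cons_of_ne_nil hu
  rw [starLeading, starWeight_one]
  rfl

theorem starLeading_phiWord_one_cons_cons (k : ℕ+) (u : List ℕ+) (n : ℕ) :
    starLeading (phiWord (1 :: k :: u)) n =
      X ^ n * qIntInv n * starLeading (phiWord (k :: u)) n := by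
  obtain ⟨j, v, h⟩ := List.exists_cons_of_ne_nil (phiWord_ne_nil k u)
  rw [phiWord_one_cons_cons k u h, h, starLeading, starLeading, starWeight_one_add]
  ring

/-- The duality, proved along the two recursions of `φ`. Raising the first letter prepends `z₁` to
the dual word, and `binomTransform'_sum` then yields a factor `1/[N+1]`. Prepending `z₁` raises the
first letter of the dual word, and `binomTransform'_mul` then yields `1/[N+1]` times a full
transform, which is a sum over one further index. -/
theorem binomTransform'_starLeading (k : ℕ+) (u : List ℕ+) (N : ℕ) :
    binomTransform' (fun n => starLeading (phiWord (k :: u)) (n + 1)) N =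
      qIntInv (N + 1) ^ (k : ℕ) * nestedSum dualWeight u (N + 1) := by
  have succ : ∀ (k : ℕ+) (u : List ℕ+) (N : ℕ),
      binomTransform' (fun n => starLeading (phiWord (k :: u)) (n + 1)) N =
        qIntInv (N + 1) ^ (k : ℕ) * nestedSum dualWeight u (N + 1) →
      binomTransform' (fun n => starLeading (phiWord ((k + 1) :: u)) (n + 1)) N =
        qIntInv (N + 1) ^ ((k + 1 : ℕ+) : ℕ) * nestedSum dualWeight u (N + 1) := by
    intro k u N ih
    simp only [phiWord_succ_cons, starLeading_one_cons (phiWord_ne_nil k u)]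
    rw [binomTransform'_sum, ih, PNat.add_coe, PNat.one_coe]
    ring
  induction u generalizing k N with
  | nil =>
    induction k using PNat.recOn with
    | one =>
      simp only [phiWord_one, starLeading, starWeight_one, nestedSum, mul_one]
      rw [binomTransform'_one]
      simp
    | succ k ih => exact succ k [] N ih
  | cons k' u ih =>
    induction k using PNat.recOn with
    | succ k ih' => exact succ k _ N ih'
    | one =>
      simp only [starLeading_phiWord_one_cons_cons]
      rw [binomTransform'_mul, binomTransform_eq_sum, PNat.one_coe, pow_one, nestedSum]
      congr 1
      refine Finset.sum_congr rfl fun m _ => ?_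
      rw [ih, dualWeight]
      ring

theorem nestedSum_dualWeight (k : ℕ+) (u : List ℕ+) (N : ℕ) :
    nestedSum dualWeight (k :: u) N =
      binomTransform (fun n => starLeading (phiWord (k :: u)) (n + 1)) N := by
  rw [binomTransform_eq_sum, nestedSum]
  refine Finset.sum_congr rfl fun m _ => ?_
  rw [binomTransform'_starLeading, dualWeight]
  ring

/-! ### Newton interpolation at the powers of `q` -/

/-- The value at `q^N` of the Newton series with coefficients `b`. -/
def newtonValue (b : ℕ → ℚ⟦X⟧) (N : ℕ) : ℚ⟦X⟧ :=
  ∑ n ∈ Finset.range (N + 1), b n * newtonNode N n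

/-- The value at `1` of the derivative of the Newton series with coefficients `b`, truncated and up
to sign. -/
def newtonSlope (b : ℕ → ℚ⟦X⟧) (M : ℕ) : ℚ⟦X⟧ :=
  ∑ n ∈ Finset.range M, b (n + 1) * ∏ j ∈ Finset.range n, (X ^ (j + 1) - 1)

/-- The truncated Newton series with coefficients `b`, as a polynomial. -/
def newtonPoly (b : ℕ → ℚ⟦X⟧) (M : ℕ) : Polynomial ℚ⟦X⟧ :=
  ∑ n ∈ Finset.range (M + 1), Polynomial.C (b n) *
    ∏ j ∈ Finset.range n, (Polynomial.C (X ^ j : ℚ⟦X⟧) - Polynomial.X)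

theorem eval_newtonPoly (b : ℕ → ℚ⟦X⟧) {M N : ℕ} (h : N ≤ M) :
    (newtonPoly b M).eval (X ^ N) = newtonValue b N := by
  simp only [newtonPoly, Polynomial.eval_finsetSum, Polynomial.eval_mul, Polynomial.eval_C,
    Polynomial.eval_prod, Polynomial.eval_sub, Polynomial.eval_X]
  rw [newtonValue]
  symm
  refine Finset.sum_subset (Finset.range_mono (by omega)) fun n _ hn => ?_
  rw [newtonNode_eq_zero (by simpa using hn), mul_zero]

/-- Every non-constant Newton basis polynomial contains the node `x = 1`. Splitting off `1 - x`
exposes both the value and the derivative at `1`. -/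
theorem newtonPoly_eq (b : ℕ → ℚ⟦X⟧) (M : ℕ) :
    newtonPoly b M = (1 - Polynomial.X) * (∑ n ∈ Finset.range M, Polynomial.C (b (n + 1)) *
      ∏ j ∈ Finset.range n, (Polynomial.C (X ^ (j + 1) : ℚ⟦X⟧) - Polynomial.X)) +
        Polynomial.C (b 0) := by
  rw [newtonPoly, Finset.sum_range_succ', Finset.mul_sum]
  refine congrArg₂ (· + ·) ?_ ?_
  · refine Finset.sum_congr rfl fun n _ => ?_
    rw [Finset.prod_range_succ', pow_zero, Polynomial.C_1]
    ring
  · simp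

theorem eval_one_newtonPoly (b : ℕ → ℚ⟦X⟧) (M : ℕ) : (newtonPoly b M).eval 1 = b 0 := by
  rw [newtonPoly_eq]
  simp

theorem eval_one_derivative_newtonPoly (b : ℕ → ℚ⟦X⟧) (M : ℕ) :
    (Polynomial.derivative (newtonPoly b M)).eval 1 = -newtonSlope b M := by
  rw [newtonPoly_eq, Polynomial.derivative_add, Polynomial.derivative_mul, Polynomial.derivative_C]
  simp [Polynomial.eval_finsetSum, Polynomial.eval_prod, newtonSlope]

theorem X_pow_injective : Function.Injective fun j : ℕ => (X ^ j : ℚ⟦X⟧) := fun i j h => by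
  have := congrArg order h
  simpa [order_X_pow] using this

theorem prod_X_sub_X_pow_dvd {G : Polynomial ℚ⟦X⟧} {M : ℕ}
    (hG : ∀ j < M, G.eval (X ^ j : ℚ⟦X⟧) = 0) :
    ∏ j ∈ Finset.range M, (Polynomial.X - Polynomial.C (X ^ j : ℚ⟦X⟧)) ∣ G := by
  rcases eq_or_ne G 0 with rfl | h0
  · exact dvd_zero _
  have := (Multiset.prod_X_sub_C_dvd_iff_le_roots h0
    ((Finset.range M).val.map fun j => (X ^ j : ℚ⟦X⟧))).mpr ?_
  · rwa [Multiset.map_map] at this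
  · rw [Multiset.le_iff_subset ((Finset.range M).nodup.map X_pow_injective)]
    intro a ha
    obtain ⟨j, hj, rfl⟩ := Multiset.mem_map.mp ha
    rw [Polynomial.mem_roots h0]
    exact hG j (by simpa using hj)

/-- Terms with `n ≥ K` die modulo `q^K`, and those with `n < K` have degree at most `n`; the bound
does not depend on `M`. -/
theorem natDegree_map_newtonPoly_le {b : ℕ → ℚ⟦X⟧} (hb : ∀ n, X ^ n ∣ b n) (K M : ℕ) :
    ((newtonPoly b M).map (Ideal.Quotient.mk (Ideal.span {(X : ℚ⟦X⟧) ^ K}))).natDegree ≤ K := by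
  rw [newtonPoly, Polynomial.map_sum]
  refine Polynomial.natDegree_sum_le_of_forall_le _ _ fun n _ => ?_
  rw [Polynomial.map_mul, Polynomial.map_C]
  rcases le_or_gt K n with h | h
  · rw [Ideal.Quotient.eq_zero_iff_mem.mpr
      (Ideal.mem_span_singleton.mpr ((pow_dvd_pow X h).trans (hb n)))]
    simp
  · refine (Polynomial.natDegree_C_mul_le _ _).trans (le_trans ?_ h.le)
    rw [Polynomial.map_prod]
    refine (Polynomial.natDegree_prod_le _ _).trans ?_
    refine (Finset.sum_le_card_nsmul _ _ 1 fun j _ => ?_).trans (by simp)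
    refine (Polynomial.natDegree_map_le).trans ?_
    exact (Polynomial.natDegree_sub_le _ _).trans (by simp)

/-- If the product of two Newton series with coefficients tending to zero agrees with a third one
at all powers of `q`, then the polynomial truncations agree modulo `q^K`. -/
theorem C_X_pow_dvd_newtonPoly {b₁ b₂ b₃ : ℕ → ℚ⟦X⟧} (h₁ : ∀ n, X ^ n ∣ b₁ n)
    (h₂ : ∀ n, X ^ n ∣ b₂ n) (h₃ : ∀ n, X ^ n ∣ b₃ n)
    (h : ∀ N, newtonValue b₁ N * newtonValue b₂ N = newtonValue b₃ N) {K M : ℕ} (hM : 2 * K ≤ M) :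
    Polynomial.C (X ^ K : ℚ⟦X⟧) ∣ newtonPoly b₁ M * newtonPoly b₂ M - newtonPoly b₃ M := by
  set G := newtonPoly b₁ M * newtonPoly b₂ M - newtonPoly b₃ M with hG
  set π := Ideal.Quotient.mk (Ideal.span {(X : ℚ⟦X⟧) ^ K}) with hπ
  suffices H : G.map π = 0 by
    rw [Polynomial.C_dvd_iff_dvd_coeff]
    intro i
    have := congrArg (fun p => Polynomial.coeff p i) H
    simp only [Polynomial.coeff_map, Polynomial.coeff_zero] at this
    exact Ideal.mem_span_singleton.mp (Ideal.Quotient.eq_zero_iff_mem.mp this)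
  -- Divisibility by the product of linear factors is established over the domain `ℚ⟦q⟧`, where the
  -- nodes are distinct, and only then reduced: modulo `q^K` roots no longer control the degree. The
  -- monic divisor has degree `M + 1 > 2K`.
  have hdvd := Polynomial.map_dvd π (prod_X_sub_X_pow_dvd (G := G) (M := M + 1) fun j hj => by
    rw [hG, Polynomial.eval_sub, Polynomial.eval_mul, eval_newtonPoly _ (by omega),
      eval_newtonPoly _ (by omega), eval_newtonPoly _ (by omega), h, sub_self])
  have hdeg : (G.map π).natDegree ≤ 2 * K := by
    rw [hG, Polynomial.map_sub, Polynomial.map_mul]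
    refine (Polynomial.natDegree_sub_le _ _).trans (max_le ?_ ?_)
    · refine Polynomial.natDegree_mul_le.trans ?_
      rw [two_mul]
      exact add_le_add (natDegree_map_newtonPoly_le h₁ K M) (natDegree_map_newtonPoly_le h₂ K M)
    · exact (natDegree_map_newtonPoly_le h₃ K M).trans (by omega)
  by_contra hne
  -- The quotient is the zero ring when `K = 0`; a nonzero polynomial over it rules this out.
  have : Nontrivial (ℚ⟦X⟧ ⧸ Ideal.span {(X : ℚ⟦X⟧) ^ K}) := by
    by_contra hs
    rw [not_nontrivial_iff_subsingleton] at hs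
    exact hne (Subsingleton.elim _ _)
  rw [Polynomial.map_prod] at hdvd
  simp only [Polynomial.map_sub, Polynomial.map_X, Polynomial.map_C] at hdvd
  have hmonic : ∀ j ∈ Finset.range (M + 1),
      (Polynomial.X - Polynomial.C (π (X ^ j))).Monic := fun j _ => Polynomial.monic_X_sub_C _
  refine (Polynomial.monic_prod_of_monic _ _ hmonic).not_dvd_of_natDegree_lt hne ?_ hdvd
  rw [Polynomial.natDegree_prod_of_monic _ _ hmonic]
  simp only [Polynomial.natDegree_X_sub_C, Finset.sum_const, Finset.card_range, smul_eq_mul]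
  omega

/-- Differentiate the congruence at `x = 1`: both factors take the value `b 0 = 0` there, so the
product rule leaves nothing but the third slope. -/
theorem X_pow_dvd_newtonSlope {b₁ b₂ b₃ : ℕ → ℚ⟦X⟧} (h₁ : ∀ n, X ^ n ∣ b₁ n)
    (h₂ : ∀ n, X ^ n ∣ b₂ n) (h₃ : ∀ n, X ^ n ∣ b₃ n) (h₁0 : b₁ 0 = 0) (h₂0 : b₂ 0 = 0)
    (h : ∀ N, newtonValue b₁ N * newtonValue b₂ N = newtonValue b₃ N) {K M : ℕ} (hM : 2 * K ≤ M) :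
    X ^ K ∣ newtonSlope b₃ M := by
  obtain ⟨H, hH⟩ := C_X_pow_dvd_newtonPoly h₁ h₂ h₃ h hM
  have := congrArg (fun p => (Polynomial.derivative p).eval 1) hH
  simp only [Polynomial.derivative_sub, Polynomial.derivative_mul, Polynomial.eval_sub,
    Polynomial.eval_add, Polynomial.eval_mul, eval_one_newtonPoly, h₁0, h₂0,
    eval_one_derivative_newtonPoly, Polynomial.derivative_C, Polynomial.eval_zero,
    Polynomial.eval_C] at this
  exact ⟨(Polynomial.derivative H).eval 1, by linear_combination this⟩

/-- The Newton coefficients of the function `q^N ↦ nestedSum dualWeight u N`. -/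
def newtonCoeff (u : List ℕ+) : ℕ → ℚ⟦X⟧
  | 0 => if u = [] then 1 else 0
  | n + 1 => (-1) ^ n * X ^ (n + 1) * starLeading (phiWord u) (n + 1) * (qPoch (n + 1))⁻¹

theorem newtonValue_newtonCoeff (u : List ℕ+) (N : ℕ) :
    newtonValue (newtonCoeff u) N = nestedSum dualWeight u N := by
  rw [newtonValue, Finset.sum_range_succ']
  cases u with
  | nil => simp [newtonCoeff, phiWord_nil, starLeading, nestedSum, newtonNode]
  | cons k u =>
    rw [nestedSum_dualWeight, binomTransform]
    simp only [newtonCoeff, reduceCtorEq, if_false, zero_mul, add_zero]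
    refine Finset.sum_congr rfl fun n _ => ?_
    rw [qBinom]
    ring

theorem X_pow_dvd_newtonCoeff (u : List ℕ+) (n : ℕ) : X ^ n ∣ newtonCoeff u n := by
  cases n with
  | zero => simp
  | succ n => exact ⟨(-1) ^ n * starLeading (phiWord u) (n + 1) * (qPoch (n + 1))⁻¹, by
      rw [newtonCoeff]; ring⟩

theorem prod_X_pow_sub_one (n : ℕ) :
    ∏ j ∈ Finset.range n, (X ^ (j + 1) - 1 : ℚ⟦X⟧) = (-1) ^ n * qPoch n := by
  rw [qPoch, ← Finset.card_range n, ← Finset.prod_const, Finset.card_range,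
    ← Finset.prod_mul_distrib]
  exact Finset.prod_congr rfl fun j _ => by ring

/-- The node product at `x = 1` cancels the sign and all of the denominator `(1-q)⋯(1-q^{n+1})`
except its last factor, and `(1-q)/(1-q^{n+1}) = 1/[n+1]`. The extra weight `q^{n+1}/[n+1]` is the
effect of `z₁ ∘` on the leading letter. -/
theorem one_sub_X_mul_newtonSlope (u : List ℕ+) (M : ℕ) :
    (1 - X) * newtonSlope (newtonCoeff u) M = ∑ n ∈ Finset.range M,
      X ^ (n + 1) * qIntInv (n + 1) * starLeading (phiWord u) (n + 1) := by
  rw [newtonSlope, Finset.mul_sum]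
  refine Finset.sum_congr rfl fun n _ => ?_
  rw [prod_X_pow_sub_one, newtonCoeff]
  have h1 := qPoch_mul_inv (n + 1)
  have h2 := one_sub_X_pow_mul_qIntInv (m := n + 1) (by omega)
  have h3 : ((-1 : ℚ⟦X⟧) ^ n) * (-1) ^ n = 1 := by rw [← mul_pow]; simp
  have h4 := qPoch_succ n
  have h5 : (1 - X) * (qPoch n * (qPoch (n + 1))⁻¹) = qIntInv (n + 1) := by
    linear_combination -(qPoch n * (qPoch (n + 1))⁻¹) * h2 + qIntInv (n + 1) * h1 -
      qIntInv (n + 1) * (qPoch (n + 1))⁻¹ * h4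
  linear_combination X ^ (n + 1) * starLeading (phiWord u) (n + 1) *
    (h5 + (1 - X) * qPoch n * (qPoch (n + 1))⁻¹ * h3)

/-! ### Convergence of the star series -/

theorem starTerm_cons (k : ℕ+) (u : List ℕ+) {a : ℕ} (ha : a ≠ 0) (m : Fin u.length → ℕ) :
    starTerm (k :: u) (Fin.cons a m : Fin (u.length + 1) → ℕ) =
      starWeight k a * starTerm u m := by
  rw [starTerm, starTerm, starWeight, ← inv_qInt_pow ha]
  exact Fin.prod_univ_succ _

open Classical in
/-- The indices `N ≥ m₁ ≥ ⋯ ≥ m_r ≥ 1`. -/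
def boundedIndex (r N : ℕ) : Finset (Fin r → ℕ) :=
  (Fintype.piFinset fun _ => Finset.Icc 1 N).filter Antitone

theorem mem_boundedIndex {r N : ℕ} {m : Fin r → ℕ} :
    m ∈ boundedIndex r N ↔ (∀ j, 1 ≤ m j ∧ m j ≤ N) ∧ Antitone m := by
  simp [boundedIndex]

theorem cons_mem_boundedIndex {r N a : ℕ} {m : Fin r → ℕ} :
    (Fin.cons a m : Fin (r + 1) → ℕ) ∈ boundedIndex (r + 1) N ↔
      1 ≤ a ∧ a ≤ N ∧ m ∈ boundedIndex r a := by
  simp only [mem_boundedIndex, Fin.forall_fin_succ, Fin.cons_zero, Fin.cons_succ]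
  constructor
  · rintro ⟨⟨⟨h1, h2⟩, h3⟩, h4⟩
    refine ⟨h1, h2, fun j => ⟨(h3 j).1, ?_⟩, fun i j hij => ?_⟩
    · simpa using h4 (Fin.zero_le j.succ)
    · simpa using h4 (Fin.succ_le_succ_iff.mpr hij)
  · rintro ⟨h1, h2, h3, h4⟩
    refine ⟨⟨⟨h1, h2⟩, fun j => ⟨(h3 j).1, (h3 j).2.trans h2⟩⟩, fun i j hij => ?_⟩
    induction i using Fin.cases with
    | zero =>
      induction j using Fin.cases with
      | zero => exact le_rfl
      | succ j => simpa using (h3 j).2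
    | succ i =>
      induction j using Fin.cases with
      | zero => exact absurd hij (by simp)
      | succ j => simpa using h4 (Fin.succ_le_succ_iff.mp hij)

theorem sum_boundedIndex_succ {R : Type*} [AddCommMonoid R] (r N : ℕ)
    (h : (Fin (r + 1) → ℕ) → R) :
    ∑ m ∈ boundedIndex (r + 1) N, h m =
      ∑ a ∈ Finset.range N, ∑ m ∈ boundedIndex r (a + 1), h (Fin.cons (a + 1) m) := by
  rw [Finset.sum_sigma']
  have key : ∀ m ∈ boundedIndex (r + 1) N,
      1 ≤ m 0 ∧ m 0 ≤ N ∧ Fin.tail m ∈ boundedIndex r (m 0) := fun m hm => by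
    rw [← Fin.cons_self_tail m] at hm
    simpa using cons_mem_boundedIndex.mp hm
  refine Finset.sum_bij' (fun m _ => ⟨m 0 - 1, Fin.tail m⟩)
    (fun x _ => Fin.cons (x.1 + 1) x.2) ?_ ?_ ?_ ?_ ?_
  · intro m hm
    obtain ⟨h1, h2, h3⟩ := key m hm
    simp only [Finset.mem_sigma, Finset.mem_range]
    rw [Nat.sub_add_cancel h1]
    exact ⟨by omega, h3⟩
  · rintro ⟨a, m⟩ hx
    simp only [Finset.mem_sigma, Finset.mem_range] at hx
    exact cons_mem_boundedIndex.mpr ⟨by simp, by simpa using hx.1, hx.2⟩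
  · intro m hm
    simp only
    rw [Nat.sub_add_cancel (key m hm).1, Fin.cons_self_tail]
  · rintro ⟨a, m⟩ hx
    simp
  · intro m hm
    simp only
    rw [Nat.sub_add_cancel (key m hm).1, Fin.cons_self_tail]

theorem sum_starTerm_boundedIndex (u : List ℕ+) (N : ℕ) :
    ∑ m ∈ boundedIndex u.length N, starTerm u m = nestedSum starWeight u N := by
  induction u generalizing N with
  | nil =>
    have : boundedIndex ([] : List ℕ+).length N = {Fin.elim0} := by
      ext m
      simp only [mem_boundedIndex, Finset.mem_singleton]
      exact ⟨fun _ => funext fun j => j.elim0, fun _ => ⟨fun j => j.elim0, fun i => i.elim0⟩⟩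
    rw [this]
    simp [starTerm, nestedSum]
  | cons k u ih =>
    refine (sum_boundedIndex_succ u.length N (starTerm (k :: u))).trans ?_
    rw [nestedSum]
    refine Finset.sum_congr rfl fun a _ => ?_
    rw [← ih, Finset.mul_sum]
    exact Finset.sum_congr rfl fun m _ => starTerm_cons k u (by omega) m

theorem X_pow_dvd_starTerm {k : ℕ+} (hk : 2 ≤ k) (u : List ℕ+)
    (m : Fin (k :: u).length → ℕ) : X ^ m ⟨0, by simp⟩ ∣ starTerm (k :: u) m := by
  refine dvd_trans (dvd_trans (pow_dvd_pow X ?_) (Dvd.intro _ rfl))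
    (Finset.dvd_prod_of_mem _ (Finset.mem_univ (⟨0, by simp⟩ : Fin (k :: u).length)))
  have h : 2 ≤ (k : ℕ) := by exact_mod_cast hk
  have : 1 ≤ (k : ℕ) - 1 := by omega
  exact Nat.le_mul_of_pos_left _ this

/-- As `k ≥ 2`, a term is divisible by `q^{m₁}`, so the terms with `m₁ > M` do not affect
coefficients below `q^K`. Coefficientwise the series is then a finite sum. -/
theorem X_pow_dvd_zetaStarWord_sub {k : ℕ+} (hk : 2 ≤ k) (u : List ℕ+) {K M : ℕ} (hM : K ≤ M) :
    X ^ K ∣ zetaStarWord (k :: u) - nestedSum starWeight (k :: u) M := by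
  classical
  rw [X_pow_dvd_iff]
  intro d hd
  rw [map_sub, sub_eq_zero]
  let _ : TopologicalSpace ℚ := ⊥
  have : DiscreteTopology ℚ := ⟨rfl⟩
  let _ : TopologicalSpace ℚ⟦X⟧ := qAdic
  have hs : HasSum (fun m : StarIndex (k :: u).length => starTerm (k :: u) m.1)
      (zetaStarWord (k :: u)) :=
    (summable_starTerm (k :: u) (by simpa [Admissible] using hk)).hasSum
  have h1 := hs.map (coeff (R := ℚ) d).toAddMonoidHom (WithPiTopology.continuous_coeff ℚ d)
  have h2 : HasSum (fun m : StarIndex (k :: u).length => coeff d (starTerm (k :: u) m.1))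
      (∑ m ∈ (boundedIndex (k :: u).length M).subtype (fun m => Antitone m ∧ ∀ j, 1 ≤ m j),
        coeff d (starTerm (k :: u) m.1)) := by
    refine hasSum_sum_of_ne_finset_zero fun m hm => ?_
    refine X_pow_dvd_iff.mp (X_pow_dvd_starTerm hk u m.1) d (hd.trans_le (hM.trans ?_))
    by_contra hlt
    refine hm (Finset.mem_subtype.mpr (mem_boundedIndex.mpr ⟨fun j => ⟨m.2.2 j, ?_⟩, m.2.1⟩))
    exact (m.2.1 (Fin.mk_le_of_le_val (Nat.zero_le _))).trans (not_le.mp hlt).le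
  have h3 := h1.unique h2
  refine h3.trans ?_
  rw [← sum_starTerm_boundedIndex, map_sum]
  refine Finset.sum_subtype_of_mem (fun m => coeff d (starTerm (k :: u) m)) fun m hm => ?_
  obtain ⟨h4, h5⟩ := mem_boundedIndex.mp hm
  exact ⟨h5, fun j => (h4 j).1⟩

/-! ### Kawashima's relation -/

theorem circ_word_nil (i : ℕ+) : circ i (word []) = 0 := linExt_word _ _

theorem circ_word_cons (i j : ℕ+) (u : List ℕ+) : circ i (word (j :: u)) = word ((i + j) :: u) := by
  rw [circ, linExt_word, word_cons]

theorem phi_word (u : List ℕ+) : phi (word u) = word (phiWord u) := linExt_word _ _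

theorem two_le_one_add (j : ℕ+) : 2 ≤ 1 + j := by
  have := j.pos
  rw [← PNat.coe_le_coe]
  push_cast
  omega

theorem circ_one_mem_H0 (w : H1) : circ 1 w ∈ H0 := by
  induction w using word_induction with
  | h0 => rw [map_zero]; exact H0.zero_mem
  | ha x y hx hy => rw [map_add]; exact H0.add_mem hx hy
  | hs c x hx => rw [map_smul]; exact H0.smul_mem c hx
  | hw u =>
    cases u with
    | nil => rw [circ_word_nil]; exact H0.zero_mem
    | cons j u =>
      rw [circ_word_cons]
      exact Submodule.subset_span ⟨_, by simpa [Admissible] using two_le_one_add j, rfl⟩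

/-- The Newton coefficients attached to an element of `H1`. -/
def newtonCoeffExt (w : H1) (n : ℕ) : ℚ⟦X⟧ := wordExt (newtonCoeff · n) w

theorem newtonValue_newtonCoeffExt (w : H1) (N : ℕ) :
    newtonValue (newtonCoeffExt w) N = wordExt (nestedSum dualWeight · N) w := by
  unfold newtonValue newtonCoeffExt
  induction w using word_induction with
  | h0 => simp [wordExt_zero]
  | ha x y hx hy => simp only [wordExt_add, add_mul, Finset.sum_add_distrib, hx, hy]
  | hs c x hx => simp only [wordExt_smul, mul_assoc, ← Finset.mul_sum, hx]
  | hw u => simp only [wordExt_word, ← newtonValue_newtonCoeff]; rfl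

theorem X_pow_dvd_newtonCoeffExt (w : H1) (n : ℕ) : X ^ n ∣ newtonCoeffExt w n := by
  unfold newtonCoeffExt
  induction w using word_induction with
  | h0 => simp [wordExt_zero]
  | ha x y hx hy => rw [wordExt_add]; exact dvd_add hx hy
  | hs c x hx => rw [wordExt_smul]; exact dvd_mul_of_dvd_right hx _
  | hw u => rw [wordExt_word]; exact X_pow_dvd_newtonCoeff u n

theorem newtonCoeffExt_zero {w : H1} (hw : w ∈ H1pos) : newtonCoeffExt w 0 = 0 := by
  unfold newtonCoeffExt
  induction hw using Submodule.span_induction with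
  | zero => exact wordExt_zero _
  | add x y _ _ hx hy => rw [wordExt_add, hx, hy, add_zero]
  | smul c x _ hx => rw [wordExt_smul, hx, mul_zero]
  | mem x hx =>
    obtain ⟨u, hu, rfl⟩ := hx
    rw [wordExt_word]
    exact if_neg hu

theorem X_pow_dvd_zetaStar_sub (w : H1) {K M : ℕ} (hM : K ≤ M) :
    X ^ K ∣ zetaStar (circ 1 (phi w)) - (1 - X) * newtonSlope (newtonCoeffExt w) M := by
  rw [zetaStar_eq_wordExt]
  unfold newtonSlope newtonCoeffExt
  induction w using word_induction with
  | h0 => simp [wordExt_zero]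
  | ha x y hx hy =>
    simp only [map_add, wordExt_add, add_mul, Finset.sum_add_distrib]
    convert dvd_add hx hy using 1
    ring
  | hs c x hx =>
    simp only [map_smul, wordExt_smul, mul_assoc, ← Finset.mul_sum]
    convert dvd_mul_of_dvd_right hx (evalHbar c) using 1
    ring
  | hw u =>
    have h := one_sub_X_mul_newtonSlope u M
    unfold newtonSlope at h
    simp only [wordExt_word, phi_word]
    rw [h]
    cases hv : phiWord u with
    | nil => simp [circ_word_nil, wordExt_zero, starLeading]
    | cons j v =>
      rw [circ_word_cons, wordExt_word]
      convert X_pow_dvd_zetaStarWord_sub (two_le_one_add j) v hM using 2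
      rw [nestedSum]
      refine Finset.sum_congr rfl fun n _ => ?_
      rw [starWeight_one_add, starLeading]
      ring

theorem zetaStar_circ_phi_starMinus {w₁ w₂ : H1} (h₁ : w₁ ∈ H1pos) (h₂ : w₂ ∈ H1pos) :
    zetaStar (circ 1 (phi (starMinus w₁ w₂))) = 0 := by
  have h : ∀ K, X ^ K ∣ zetaStar (circ 1 (phi (starMinus w₁ w₂))) := fun K => by
    -- The truncation `M = 2K` serves both purposes: interpolation needs `M ≥ 2K`, approximating the
    -- star value needs only `M ≥ K`.
    rw [← dvd_sub_left (dvd_mul_of_dvd_right (X_pow_dvd_newtonSlope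
      (X_pow_dvd_newtonCoeffExt w₁) (X_pow_dvd_newtonCoeffExt w₂)
      (X_pow_dvd_newtonCoeffExt (starMinus w₁ w₂)) (newtonCoeffExt_zero h₁)
      (newtonCoeffExt_zero h₂) (fun N => ?_) (le_refl (2 * K))) (1 - X))]
    · exact X_pow_dvd_zetaStar_sub _ (by omega)
    · simp only [newtonValue_newtonCoeffExt, wordExt_starMinus]
  ext d
  exact X_pow_dvd_iff.mp (h (d + 1)) d (Nat.lt_succ_self d)

end QMZV

end

theorem mainTheorem4 (w₁ w₂ : QMZV.H1) (h₁ : w₁ ∈ QMZV.H1pos) (h₂ : w₂ ∈ QMZV.H1pos) :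
    QMZV.circ 1 (QMZV.phi (QMZV.starMinus w₁ w₂)) ∈ QMZV.H0 ∧
      QMZV.zetaStar (QMZV.circ 1 (QMZV.phi (QMZV.starMinus w₁ w₂))) = 0 :=
  ⟨QMZV.circ_one_mem_H0 _, QMZV.zetaStar_circ_phi_starMinus h₁ h₂⟩
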